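/- Let $\mathsf{T}$ be a random locally finite tree rooted at $\varnothing$. Let $\mathsf{T}(k)$ be the subtree of its first $k$ generations, $\partial\mathsf{T}(k)$ the set of vertices at generation $k$, and $\Delta_j$ the number of offspring of the vertex $j$. Suppose that $\mathsf{T}$ is conditionally independent with average offspring numbers bounded by a constant $\Delta<\infty$: for every $k\ge 0$, conditionally on $\mathsf{T}(k)$, the numbers $\Delta_j$, $j\in\partial\mathsf{T}(k)$, are independent of each other and each has mean at most $\Delta$. Let $\underline{B}=\{B_i\}$ be real magnetic fields at the vertices, which may be deterministic or random (defined on the same probability space as $\mathsf{T}$). For $\beta\ge 0$ and $\ell\ge 1$ consider, for spins $x_i\in\{+1,-1\}$, the Ising models on $\mathsf{T}(\ell)$ with free and plus boundary conditions, $$\mu^{\ell,0}(\underline{x})=\frac{1}{Z^{\ell,0}}\exp\Big\{\beta\sum_{(ij)\in\mathsf{T}(\ell)}x_ix_j+\sum_{i\in\mathsf{T}(\ell)}B_ix_i\Big\},$$ $$\mu^{\ell,+}(\underline{x})=\frac{1}{Z^{\ell,+}}\exp\Big\{\beta\sum_{(ij)\in\mathsf{T}(\ell)}x_ix_j+\sum_{i\in\mathsf{T}(\ell)}B_ix_i\Big\}\,\mathbb{I}\big(x_i=+1\text{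 for all } i\in\partial\mathsf{T}(\ell)\big),$$ and the root magnetizations $m^{\ell,0}(\underline{B})=\sum_{\underline{x}}x_{\varnothing}\,\mu^{\ell,0}(\underline{x})$ and $m^{\ell,+}(\underline{B})=\sum_{\underline{x}}x_{\varnothing}\,\mu^{\ell,+}(\underline{x})$. For all finite $\beta_{\max}$, $\Delta$ and all $B_{\min}>0$ there is a finite constant $M=M(\beta_{\max},B_{\min},\Delta)$ such that for every such random tree $\mathsf{T}$, every $0\le\beta\le\beta_{\max}$, every $\ell\ge 1$ and all fields with $B_i\ge B_{\min}$ for all $i\in\mathsf{T}(\ell)$ almost surely, the difference $m^{\ell,+}(\underline{B})-m^{\ell,0}(\underline{B})$ is integrable and $$\mathbb{E}\{m^{\ell,+}(\underline{B})-m^{\ell,0}(\underline{B})\}\le\frac{M}{\ell}.$$ -/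

import Mathlib

open MeasureTheory ProbabilityTheory

noncomputable section

namespace IsingTree

/-! ### Ising models on finite graphs

Spins take values in `ℤˣ = {1, -1}`. -/

/-- The real value `±1` of a spin. -/
def spin (s : ℤˣ) : ℝ := ((s : ℤ) : ℝ)

/-- The product `x_i x_j` of the two spins at the ends of an edge `(i, j)`. -/
def edgeSpin {V : Type*} (x : V → ℤˣ) (e : Sym2 V) : ℝ :=
  Sym2.lift ⟨fun i j => spin (x i) * spin (x j), fun _ _ => mul_comm _ _⟩ e

open Classical in
/-- The Boltzmann weight `exp (β ∑_{(i,j) ∈ E} x_i x_j + ∑_i B_i x_i)` on a finite graph. -/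
def isingWeight {V : Type*} [Fintype V] (G : SimpleGraph V) (β : ℝ) (B : V → ℝ)
    (x : V → ℤˣ) : ℝ :=
  Real.exp (β * ∑ e ∈ G.edgeFinset, edgeSpin x e + ∑ i, B i * spin (x i))

/-- The probability distribution on a finite set that is proportional to the weight `w`. -/
def boltzmann {X : Type*} [Fintype X] (w : X → ℝ) (x : X) : ℝ := w x / ∑ y, w y

/-- The expectation `⟨ν, f⟩ = ∑_x f(x) ν(x)`. -/
def bracket {X : Type*} [Fintype X] (ν f : X → ℝ) : ℝ := ∑ x, f x * ν x

/-! ### Locally finite rooted trees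

Ulam-Harris coding: a vertex is a list of natural numbers (the most recent entry first), the root
is `[]`, and the children of the vertex `v` are `i :: v` with `i < c v`, where `c v` is the
offspring number of `v`. The values of `c` outside the tree play no role. -/

/-- The set `∂T(k)` of the vertices at generation `k` of the tree with offspring numbers `c`. -/
def generation (c : List ℕ → ℕ) : ℕ → Finset (List ℕ)
  | 0 => {[]}
  | k + 1 => (generation c k).biUnion fun v => (Finset.range (c v)).image fun i => i :: v

/-- The vertex set of the subtree `T(k)` of the first `k` generations. -/
def firstGenerations (c : List ℕ → ℕ) (k : ℕ) : Finset (List ℕ) :=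
  (Finset.range (k + 1)).biUnion (generation c)

theorem root_mem_firstGenerations (c : List ℕ → ℕ) (k : ℕ) : [] ∈ firstGenerations c k :=
  Finset.mem_biUnion.mpr ⟨0, by simp, by simp [generation]⟩

/-- The root of `T(k)`. -/
def root (c : List ℕ → ℕ) (k : ℕ) : firstGenerations c k := ⟨[], root_mem_firstGenerations c k⟩

/-- The tree `T(k)` as a graph: the edges join each vertex to its children. -/
def treeGraph (c : List ℕ → ℕ) (k : ℕ) : SimpleGraph (firstGenerations c k) :=
  SimpleGraph.fromRel fun u v => ∃ i : ℕ, v.1 = i :: u.1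

/-! ### Free and plus boundary conditions -/

/-- The Ising model `μ^{ℓ,0}` on `T(ℓ)` with free boundary condition. -/
def freeMeasure (β : ℝ) (c : List ℕ → ℕ) (B : List ℕ → ℝ) (l : ℕ) :
    (firstGenerations c l → ℤˣ) → ℝ :=
  boltzmann fun x => isingWeight (treeGraph c l) β (fun i => B i.1) x

open Classical in
/-- The Ising model `μ^{ℓ,+}` on `T(ℓ)` with all spins on `∂T(ℓ)` set to `+1`. -/
def plusMeasure (β : ℝ) (c : List ℕ → ℕ) (B : List ℕ → ℝ) (l : ℕ) :
    (firstGenerations c l → ℤˣ) → ℝ :=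
  boltzmann fun x => isingWeight (treeGraph c l) β (fun i => B i.1) x *
    (if ∀ i : firstGenerations c l, i.1 ∈ generation c l → x i = 1 then 1 else 0)

/-- The root magnetization `m^{ℓ,0}(B)`. -/
def freeMagnetization (β : ℝ) (c : List ℕ → ℕ) (B : List ℕ → ℝ) (l : ℕ) : ℝ :=
  bracket (freeMeasure β c B l) fun x => spin (x (root c l))

/-- The root magnetization `m^{ℓ,+}(B)`. -/
def plusMagnetization (β : ℝ) (c : List ℕ → ℕ) (B : List ℕ → ℝ) (l : ℕ) : ℝ :=
  bracket (plusMeasure β c B l) fun x => spin (x (root c l))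

/-! ### Conditionally independent random trees -/

/-- The random tree with offspring numbers `N v` is conditionally independent, with conditional
mean offspring numbers at most `Δ`: for each `k` and each value `t` that `T(k)` takes with positive
probability, given `T(k) = t` the offspring numbers of the vertices of `t` at generation `k` are
independent, with means at most `Δ`. -/
structure IsConditionallyIndependentTree {Ω : Type*} [MeasurableSpace Ω] (P : Measure Ω)
    (N : List ℕ → Ω → ℕ) (Δ : ℝ) : Prop where
  measurable : ∀ v, Measurable (N v)
  indep : ∀ (k : ℕ) (t : Finset (List ℕ)),
    P {ω | firstGenerations (fun v => N v ω) k = t} ≠ 0 →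
      iIndepFun (fun j : {v : List ℕ // v ∈ t ∧ v.length = k} => N j.1)
        (ProbabilityTheory.cond P {ω | firstGenerations (fun v => N v ω) k = t})
  mean_le : ∀ (k : ℕ) (t : Finset (List ℕ)),
    P {ω | firstGenerations (fun v => N v ω) k = t} ≠ 0 →
      ∀ v ∈ t, v.length = k →
        Integrable (fun ω => (N v ω : ℝ))
            (ProbabilityTheory.cond P {ω | firstGenerations (fun v => N v ω) k = t}) ∧
          ∫ ω, (N v ω : ℝ)
            ∂(ProbabilityTheory.cond P {ω | firstGenerations (fun v => N v ω) k = t}) ≤ Δ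

end IsingTree

end

/-! Summing out the last generation of a tree turns each leaf with field `h` into an extra field
`message β h` on its parent. The root magnetization is therefore `tanh` of a recursively computed
field `cavity` (`freeMagnetization_eq`, `plusMagnetization_eq`); plus spins at depth `k + 1` amount
to an extra field `β` per child at depth `k`. For `β ≥ 0` both `message β` and `tanh` are increasing
and concave on `[0, ∞)`, and the estimates rest on this.

By concavity the gap between the boundary conditions shrinks as the fields grow
(`tanh_cavity_gap_le`), so a constant field `b = Bmin` is the worst case. Let `F k` be the free
magnetization at depth `k` and `U k` the plus magnetization at depth `k + 1`. Since `U` decreases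
and `F` increases, `U n - F (n + 1) ≤ U (k + 1) - F (k + 1)` for every `k < n`.

Given the first `k + 1` generations, Jensen replaces the random leaf fields in `U (k + 1)` by their
means, at most `b + K` with `K ≥ β Δ` (`integral_tanh_cavity_plus_le`). As a function of a common
leaf field `s ≥ 0` the magnetization is concave; it equals `F (k + 1)` at `s = b` and `F k` at `s =
0`. So raising `s` from `b` to `b + K` gains at most `K / b * (F (k + 1) - F k)`
(`tanh_cavity_sub_le`). Summing over `k < n` telescopes in expectation to at most `K / b`, which is
the `M / l` rate (`mul_integral_gap_le`). -/

noncomputable section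

namespace IsingTree

/-! ### The one-edge message and its concavity -/

/-- A concave monotone function on `[0, ∞)` has decreasing increments. -/
theorem sub_le_sub_of_concaveOn {f : ℝ → ℝ} (hf : ConcaveOn ℝ (Set.Ici 0) f)
    (hm : MonotoneOn f (Set.Ici 0)) {p p' q q' : ℝ} (hq : 0 ≤ q) (hqp : q ≤ p) (hp : p ≤ p')
    (h : p' - p ≤ q' - q) : f p' - f p ≤ f q' - f q := by
  have h1 : f (q + (p' - p)) ≤ f q' :=
    hm (Set.mem_Ici.2 (by linarith)) (Set.mem_Ici.2 (by linarith)) (by linarith)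
  rcases eq_or_lt_of_le (hqp.trans hp) with he | hlt
  · obtain rfl : q = p := by linarith
    have : f p' = f (q + (p' - q)) := by congr 1; ring
    linarith
  · have hd : 0 < p' - q := by linarith
    have hd' : p' - q ≠ 0 := hd.ne'
    -- The points `p` and `q + (p' - p)` are convex combinations of `q` and `p'` with exchanged
    -- weights, so adding the two concavity inequalities gives `f q + f p'` on the left.
    have e1 : (p' - p) / (p' - q) + (p - q) / (p' - q) = 1 := by field_simp; ring
    have e2 : (p - q) / (p' - q) + (p' - p) / (p' - q) = 1 := by field_simp; ring
    have n1 : 0 ≤ (p' - p) / (p' - q) := div_nonneg (by linarith) hd.le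
    have n2 : 0 ≤ (p - q) / (p' - q) := div_nonneg (by linarith) hd.le
    have hqm : q ∈ Set.Ici (0 : ℝ) := hq
    have hpm : p' ∈ Set.Ici (0 : ℝ) := Set.mem_Ici.2 (by linarith)
    have k1 := hf.2 hqm hpm n1 n2 e1
    have k2 := hf.2 hqm hpm n2 n1 e2
    have x1 : (p' - p) / (p' - q) * q + (p - q) / (p' - q) * p' = p := by field_simp; ring
    have x2 : (p - q) / (p' - q) * q + (p' - p) / (p' - q) * p' = q + (p' - p) := by
      field_simp; ring
    simp only [smul_eq_mul, x1, x2] at k1 k2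
    have : (p' - p) / (p' - q) * f q + (p - q) / (p' - q) * f p' +
        ((p - q) / (p' - q) * f q + (p' - p) / (p' - q) * f p') = f q + f p' := by
      linear_combination (f q + f p') * e1
    linarith

theorem hasDerivAt_tanh (x : ℝ) : HasDerivAt Real.tanh (1 / Real.cosh x ^ 2) x := by
  have h := (Real.hasDerivAt_sinh x).div (Real.hasDerivAt_cosh x) (Real.cosh_pos x).ne'
  have e : Real.tanh = Real.sinh / Real.cosh := by
    funext y; exact Real.tanh_eq_sinh_div_cosh y
  rw [e]
  refine h.congr_deriv ?_
  rw [← Real.cosh_sq_sub_sinh_sq x]; ring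

theorem continuous_tanh : Continuous Real.tanh :=
  continuous_iff_continuousAt.2 fun x => (hasDerivAt_tanh x).continuousAt

theorem monotone_tanh : Monotone Real.tanh :=
  monotone_of_deriv_nonneg (fun x => (hasDerivAt_tanh x).differentiableAt) fun x => by
    rw [(hasDerivAt_tanh x).deriv]; positivity

theorem concaveOn_tanh : ConcaveOn ℝ (Set.Ici 0) Real.tanh := by
  refine AntitoneOn.concaveOn_of_deriv (convex_Ici 0) continuous_tanh.continuousOn
    (fun x _ => (hasDerivAt_tanh x).differentiableAt.differentiableWithinAt) ?_
  intro x hx y hy hxy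
  rw [interior_Ici, Set.mem_Ioi] at hx hy
  rw [(hasDerivAt_tanh x).deriv, (hasDerivAt_tanh y).deriv]
  have := Real.cosh_le_cosh.2 (by rwa [abs_of_pos hx, abs_of_pos hy] : |x| ≤ |y|)
  have := Real.cosh_pos x
  gcongr

theorem tanh_nonneg {x : ℝ} (hx : 0 ≤ x) : 0 ≤ Real.tanh x := by
  simpa using monotone_tanh hx

theorem abs_tanh_le_one (x : ℝ) : |Real.tanh x| ≤ 1 := by
  rw [Real.tanh_eq_sinh_div_cosh, abs_div, abs_of_pos (Real.cosh_pos x),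
    div_le_one (Real.cosh_pos x), abs_le]
  have h1 := Real.exp_pos x
  have h2 := Real.exp_pos (-x)
  rw [Real.sinh_eq, Real.cosh_eq]
  constructor <;> linarith

/-- The effective field that a vertex with field `h` induces on its parent. -/
def message (β h : ℝ) : ℝ :=
  (Real.log (Real.cosh (h + β)) - Real.log (Real.cosh (h - β))) / 2

/-- In this form the derivative is visibly nonnegative, and decreasing in `h ≥ 0`, when `β ≥ 0`. -/
theorem hasDerivAt_message (β h : ℝ) :
    HasDerivAt (message β) (Real.sinh (2 * β) / (Real.cosh (2 * h) + Real.cosh (2 * β))) h := by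
  have h1 : HasDerivAt (fun x => Real.cosh (x + β)) (Real.sinh (h + β)) h := by
    simpa using ((hasDerivAt_id h).add_const β).cosh
  have h2 : HasDerivAt (fun x => Real.cosh (x - β)) (Real.sinh (h - β)) h := by
    simpa using ((hasDerivAt_id h).sub_const β).cosh
  have c1 := Real.cosh_pos (h + β)
  have c2 := Real.cosh_pos (h - β)
  have h3 := ((h1.log c1.ne').sub (h2.log c2.ne')).div_const 2
  refine h3.congr_deriv ?_
  have e1 : Real.cosh (2 * h) + Real.cosh (2 * β) = 2 * (Real.cosh (h + β) * Real.cosh (h - β)) := by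
    have : 2 * h = (h + β) + (h - β) := by ring
    rw [this, Real.cosh_add]
    have : 2 * β = (h + β) - (h - β) := by ring
    rw [this, Real.cosh_sub (h + β) (h - β)]; ring
  have e2 : Real.sinh (2 * β) =
      Real.sinh (h + β) * Real.cosh (h - β) - Real.cosh (h + β) * Real.sinh (h - β) := by
    have : 2 * β = (h + β) - (h - β) := by ring
    rw [this, Real.sinh_sub]
  rw [e1, e2]
  field_simp

theorem continuous_message (β : ℝ) : Continuous (message β) :=
  continuous_iff_continuousAt.2 fun x => (hasDerivAt_message β x).continuousAt

@[simp]
theorem message_zero (β : ℝ) : message β 0 = 0 := by simp [message]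

theorem monotone_message {β : ℝ} (hβ : 0 ≤ β) : Monotone (message β) :=
  monotone_of_deriv_nonneg (fun x => (hasDerivAt_message β x).differentiableAt) fun x => by
    rw [(hasDerivAt_message β x).deriv]
    have := Real.sinh_nonneg_iff.2 (by linarith : 0 ≤ 2 * β)
    have := Real.cosh_pos (2 * x)
    have := Real.cosh_pos (2 * β)
    positivity

theorem message_nonneg {β h : ℝ} (hβ : 0 ≤ β) (hh : 0 ≤ h) : 0 ≤ message β h := by
  simpa using monotone_message hβ hh

theorem concaveOn_message {β : ℝ} (hβ : 0 ≤ β) : ConcaveOn ℝ (Set.Ici 0) (message β) := by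
  refine AntitoneOn.concaveOn_of_deriv (convex_Ici 0) (continuous_message β).continuousOn
    (fun x _ => (hasDerivAt_message β x).differentiableAt.differentiableWithinAt) ?_
  intro x hx y hy hxy
  rw [interior_Ici, Set.mem_Ioi] at hx hy
  rw [(hasDerivAt_message β x).deriv, (hasDerivAt_message β y).deriv]
  have h1 : Real.cosh (2 * x) ≤ Real.cosh (2 * y) :=
    Real.cosh_le_cosh.2 (by rw [abs_of_pos (by linarith), abs_of_pos (by linarith)]; linarith)
  have := Real.sinh_nonneg_iff.2 (by linarith : 0 ≤ 2 * β)
  have := Real.cosh_pos (2 * x)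
  have := Real.cosh_pos (2 * β)
  gcongr

/-- The bound is the message of a child pinned to `+1`, the limit `h → ∞`; this is why the plus
condition dominates. -/
theorem message_le {β : ℝ} (hβ : 0 ≤ β) (h : ℝ) : message β h ≤ β := by
  have c1 := Real.cosh_pos (h + β)
  have c2 := Real.cosh_pos (h - β)
  have key : Real.cosh (h + β) ≤ Real.exp (2 * β) * Real.cosh (h - β) := by
    rw [Real.cosh_eq, Real.cosh_eq]
    have e1 : Real.exp (2 * β) * Real.exp (h - β) = Real.exp (h + β) := by
      rw [← Real.exp_add]; ring_nf
    have e2 : Real.exp (2 * β) * Real.exp (-(h - β)) = Real.exp (-(h + β) + 4 * β) := by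
      rw [← Real.exp_add]; ring_nf
    have e3 : Real.exp (-(h + β)) ≤ Real.exp (-(h + β) + 4 * β) :=
      Real.exp_le_exp.2 (by linarith)
    rw [mul_div_assoc', mul_add, e1, e2]
    linarith
  have := Real.log_le_log c1 key
  rw [Real.log_mul (Real.exp_pos _).ne' c2.ne', Real.log_exp] at this
  unfold message
  linarith

/-! ### Effective fields on a tree -/

/-- The effective field at `v` of the tree cut `n` generations below `v`, with field `B` inside and
field `g` on the last generation. -/
def cavity (β : ℝ) (c : List ℕ → ℕ) (B g : List ℕ → ℝ) : ℕ → List ℕ → ℝ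
  | 0, v => g v
  | n + 1, v => B v + ∑ i ∈ Finset.range (c v), message β (cavity β c B g n (i :: v))

variable {β : ℝ} {c : List ℕ → ℕ}

/-- The definition recurses from the root; this peels off the bottom generation instead, so that
boundary conditions at different depths can be compared at the same depth. -/
theorem cavity_succ (B g : List ℕ → ℝ) (n : ℕ) (v : List ℕ) :
    cavity β c B g (n + 1) v =
      cavity β c B (fun w => B w + ∑ i ∈ Finset.range (c w), message β (g (i :: w))) n v := by
  induction n generalizing v with
  | zero => rfl
  | succ n ih => rw [cavity, cavity]; simp only [ih]

theorem cavity_mono (hβ : 0 ≤ β) (B : List ℕ → ℝ) {g g' : List ℕ → ℝ} (h : ∀ v, g v ≤ g' v)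
    (n : ℕ) (v : List ℕ) : cavity β c B g n v ≤ cavity β c B g' n v := by
  induction n generalizing v with
  | zero => exact h v
  | succ n ih =>
    rw [cavity, cavity]
    gcongr
    exact monotone_message hβ (ih _)

theorem cavity_nonneg (hβ : 0 ≤ β) {B g : List ℕ → ℝ} (hB : ∀ v, 0 ≤ B v) (hg : ∀ v, 0 ≤ g v)
    (n : ℕ) (v : List ℕ) : 0 ≤ cavity β c B g n v := by
  induction n generalizing v with
  | zero => exact hg v
  | succ n ih =>
    rw [cavity]
    exact add_nonneg (hB v) (Finset.sum_nonneg fun i _ => message_nonneg hβ (ih _))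

theorem cavity_mono_inner (hβ : 0 ≤ β) {B B' g g' : List ℕ → ℝ} (hB : ∀ v, B v ≤ B' v)
    (h : ∀ v, g v ≤ g' v) (n : ℕ) (v : List ℕ) :
    cavity β c B g n v ≤ cavity β c B' g' n v := by
  induction n generalizing v with
  | zero => exact h v
  | succ n ih =>
    rw [cavity, cavity]
    gcongr
    · exact hB v
    · exact monotone_message hβ (ih _)

/-- The effect of raising the fields on the last generation decreases with the fields. -/
theorem cavity_sub_le_sub (hβ : 0 ≤ β) {b B q q' p p' : List ℕ → ℝ} (hb : ∀ v, 0 ≤ b v)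
    (hbB : ∀ v, b v ≤ B v) (hq : ∀ v, 0 ≤ q v) (hqp : ∀ v, q v ≤ p v) (hp : ∀ v, p v ≤ p' v)
    (h : ∀ v, p' v - p v ≤ q' v - q v) (n : ℕ) (v : List ℕ) :
    cavity β c B p' n v - cavity β c B p n v ≤ cavity β c b q' n v - cavity β c b q n v := by
  induction n generalizing v with
  | zero => exact h v
  | succ n ih =>
    simp only [cavity, add_sub_add_left_eq_sub, ← Finset.sum_sub_distrib]
    refine Finset.sum_le_sum fun i _ => ?_
    exact sub_le_sub_of_concaveOn (concaveOn_message hβ) ((monotone_message hβ).monotoneOn _)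
      (cavity_nonneg hβ hb hq _ _) (cavity_mono_inner hβ hbB hqp _ _) (cavity_mono hβ B hp _ _)
      (ih _)

/-- Concavity survives sums and composition with the increasing concave `message β`. -/
theorem concaveOn_cavity_const (hβ : 0 ≤ β) {B : List ℕ → ℝ} (hB : ∀ v, 0 ≤ B v) (n : ℕ)
    (v : List ℕ) :
    ConcaveOn ℝ (Set.Ici 0) fun s : ℝ => cavity β c B (fun _ => s) n v := by
  induction n generalizing v with
  | zero => exact concaveOn_id (convex_Ici 0)
  | succ n ih =>
    simp only [cavity]
    refine ⟨convex_Ici 0, fun x hx y hy a b ha hb hab => ?_⟩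
    simp only [smul_eq_mul, mul_add, Finset.mul_sum]
    have : a * B v + b * B v = B v := by rw [← add_mul, hab, one_mul]
    calc _ = B v + ∑ i ∈ Finset.range (c v),
          (a * message β (cavity β c B (fun _ => x) n (i :: v)) +
            b * message β (cavity β c B (fun _ => y) n (i :: v))) := by
          rw [Finset.sum_add_distrib]; linarith
      _ ≤ _ := by
        gcongr with i
        have nx := cavity_nonneg (c := c) hβ hB (g := fun _ => x) (fun _ => hx) n (i :: v)
        have ny := cavity_nonneg (c := c) hβ hB (g := fun _ => y) (fun _ => hy) n (i :: v)
        refine ((concaveOn_message hβ).2 nx ny ha hb hab).trans ?_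
        exact monotone_message hβ ((ih (i :: v)).2 hx hy ha hb hab)

/-- Concavity bounds the effect of a field `K` on the last generation by that of the last
generation itself. -/
theorem tanh_cavity_sub_le (hβ : 0 ≤ β) {b K : ℝ} (hb : 0 < b) (hK : 0 < K) (n : ℕ) :
    Real.tanh (cavity β c (fun _ => b) (fun _ => b + K) (n + 1) []) -
        Real.tanh (cavity β c (fun _ => b) (fun _ => b) (n + 1) []) ≤
      K / b * (Real.tanh (cavity β c (fun _ => b) (fun _ => b) (n + 1) []) -
        Real.tanh (cavity β c (fun _ => b) (fun _ => b) n [])) := by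
  set f : ℝ → ℝ := fun s => Real.tanh (cavity β c (fun _ => b) (fun _ => s) (n + 1) []) with hf
  have hc : ConcaveOn ℝ (Set.Ici 0) f := by
    refine ⟨convex_Ici 0, fun x hx y hy a a' ha ha' haa => ?_⟩
    have nx := cavity_nonneg (c := c) hβ (B := fun _ => b) (g := fun _ => x)
      (fun _ => hb.le) (fun _ => hx) (n + 1) []
    have ny := cavity_nonneg (c := c) hβ (B := fun _ => b) (g := fun _ => y)
      (fun _ => hb.le) (fun _ => hy) (n + 1) []
    exact (concaveOn_tanh.2 nx ny ha ha' haa).trans (monotone_tanh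
      ((concaveOn_cavity_const hβ (fun _ => hb.le) (n + 1) []).2 hx hy ha ha' haa))
  -- Leaves with zero field send zero messages, so the last generation disappears.
  have h0 : f 0 = Real.tanh (cavity β c (fun _ => b) (fun _ => b) n []) := by
    simp only [hf, cavity_succ, message_zero, Finset.sum_const_zero, add_zero]
  have hs := hc.slope_anti_adjacent (x := 0) (y := b) (z := b + K) (Set.mem_Ici.2 le_rfl)
    (Set.mem_Ici.2 (by linarith)) hb (by linarith)
  rw [h0, add_sub_cancel_left, sub_zero, div_le_iff₀ hK] at hs
  calc _ ≤ _ := hs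
    _ = _ := by simp only [hf]; ring

/-- A vertex contributes at most `β` to the field of its parent. -/
theorem cavity_plus_le (hβ : 0 ≤ β) (B : List ℕ → ℝ) {k l : ℕ} (hkl : k ≤ l) (v : List ℕ) :
    cavity β c B (fun v => B v + β * c v) l v ≤ cavity β c B (fun v => B v + β * c v) k v := by
  induction l, hkl using Nat.le_induction with
  | base => exact le_rfl
  | succ l _ ih =>
    refine le_trans ?_ ih
    rw [cavity_succ]
    refine cavity_mono hβ B (fun w => ?_) l v
    have : ∑ i ∈ Finset.range (c w), message β (B (i :: w) + β * c (i :: w)) ≤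
        ∑ _i ∈ Finset.range (c w), β := Finset.sum_le_sum fun i _ => message_le hβ _
    simp only [Finset.sum_const, Finset.card_range, nsmul_eq_mul] at this
    linarith

theorem cavity_free_le (hβ : 0 ≤ β) {B : List ℕ → ℝ} (hB : ∀ v, 0 ≤ B v) {k l : ℕ} (hkl : k ≤ l)
    (v : List ℕ) : cavity β c B B k v ≤ cavity β c B B l v := by
  induction l, hkl using Nat.le_induction with
  | base => exact le_rfl
  | succ l _ ih =>
    refine ih.trans ?_
    rw [cavity_succ]
    exact cavity_mono hβ B (fun w => le_add_of_nonneg_right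
      (Finset.sum_nonneg fun i _ => message_nonneg hβ (hB _))) l v

/-- The gap between plus and free boundary condition decreases with the fields. -/
theorem tanh_cavity_gap_le (hβ : 0 ≤ β) {b B : List ℕ → ℝ} (hb : ∀ v, 0 ≤ b v)
    (hbB : ∀ v, b v ≤ B v) (n : ℕ) :
    Real.tanh (cavity β c B (fun v => B v + β * c v) n []) -
        Real.tanh (cavity β c B B (n + 1) []) ≤
      Real.tanh (cavity β c b (fun v => b v + β * c v) n []) -
        Real.tanh (cavity β c b b (n + 1) []) := by
  have hB : ∀ v, 0 ≤ B v := fun v => (hb v).trans (hbB v)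
  have hsum : ∀ v, ∑ i ∈ Finset.range (c v), message β (B (i :: v)) ≤ β * c v := fun v => by
    have : ∑ i ∈ Finset.range (c v), message β (B (i :: v)) ≤
        ∑ _i ∈ Finset.range (c v), β := Finset.sum_le_sum fun i _ => message_le hβ _
    simp only [Finset.sum_const, Finset.card_range, nsmul_eq_mul] at this
    linarith
  have hle : ∀ v, ∑ i ∈ Finset.range (c v), message β (b (i :: v)) ≤
      ∑ i ∈ Finset.range (c v), message β (B (i :: v)) := fun v =>
    Finset.sum_le_sum fun i _ => monotone_message hβ (hbB _)
  have hq : ∀ v, 0 ≤ b v + ∑ i ∈ Finset.range (c v), message β (b (i :: v)) := fun v =>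
    add_nonneg (hb v) (Finset.sum_nonneg fun i _ => message_nonneg hβ (hb _))
  -- Now both boundary conditions live at depth `n`. Passing from free to plus raises a leaf field
  -- by `β * c v` minus its incoming messages, and this is smaller for `B` than for `b` because
  -- messages increase with the field.
  rw [cavity_succ, cavity_succ]
  refine sub_le_sub_of_concaveOn concaveOn_tanh (monotone_tanh.monotoneOn _) ?_ ?_ ?_ ?_
  · exact cavity_nonneg hβ hb hq n []
  · exact cavity_mono_inner hβ hbB (fun v => add_le_add (hbB v) (hle v)) n []
  · exact cavity_mono hβ B (fun v => by linarith [hsum v]) n []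
  · exact cavity_sub_le_sub hβ hb hbB hq (fun v => add_le_add (hbB v) (hle v))
      (fun v => by linarith [hsum v]) (fun v => by linarith [hle v]) n []

/-! ### Generations of a tree -/

theorem length_of_mem_generation {k : ℕ} {v : List ℕ} (h : v ∈ generation c k) : v.length = k := by
  induction k generalizing v with
  | zero => simp only [generation, Finset.mem_singleton] at h; simp [h]
  | succ k ih =>
    simp only [generation, Finset.mem_biUnion, Finset.mem_image] at h
    obtain ⟨u, hu, i, -, rfl⟩ := h
    simp [ih hu]

theorem cons_mem_generation {k i : ℕ} {v : List ℕ} :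
    i :: v ∈ generation c (k + 1) ↔ v ∈ generation c k ∧ i < c v := by
  simp only [generation, Finset.mem_biUnion, Finset.mem_image, Finset.mem_range]
  constructor
  · rintro ⟨u, hu, j, hj, he⟩
    obtain ⟨rfl, rfl⟩ := List.cons.inj he
    exact ⟨hu, hj⟩
  · rintro ⟨hv, hi⟩
    exact ⟨v, hv, i, hi, rfl⟩

theorem mem_firstGenerations {k : ℕ} {v : List ℕ} :
    v ∈ firstGenerations c k ↔ v.length ≤ k ∧ v ∈ generation c v.length := by
  simp only [firstGenerations, Finset.mem_biUnion, Finset.mem_range, Nat.lt_succ_iff]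
  constructor
  · rintro ⟨j, hj, hv⟩
    obtain rfl := length_of_mem_generation hv
    exact ⟨hj, hv⟩
  · rintro ⟨h1, h2⟩
    exact ⟨_, h1, h2⟩

theorem firstGenerations_succ (k : ℕ) :
    firstGenerations c (k + 1) = firstGenerations c k ∪ generation c (k + 1) := by
  rw [firstGenerations, Finset.range_add_one, Finset.biUnion_insert, Finset.union_comm]; rfl

theorem disjoint_firstGenerations_generation (k : ℕ) :
    Disjoint (firstGenerations c k) (generation c (k + 1)) := by
  rw [Finset.disjoint_left]
  intro v h1 h2
  have := (mem_firstGenerations.1 h1).1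
  have := length_of_mem_generation h2
  omega

theorem tail_mem_firstGenerations {k : ℕ} {v : List ℕ} (h : v ∈ firstGenerations c k) :
    v.tail ∈ firstGenerations c k := by
  cases v with
  | nil => exact h
  | cons i v =>
    rw [mem_firstGenerations, List.length_cons, cons_mem_generation] at h
    exact mem_firstGenerations.2 ⟨by simp only [List.tail_cons]; omega, h.2.1⟩

theorem sum_generation_succ {M : Type*} [AddCommMonoid M] (k : ℕ) (f : List ℕ → M) :
    ∑ w ∈ generation c (k + 1), f w =
      ∑ v ∈ generation c k, ∑ i ∈ Finset.range (c v), f (i :: v) := by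
  rw [generation, Finset.sum_biUnion]
  · refine Finset.sum_congr rfl fun v _ => ?_
    rw [Finset.sum_image]
    intro i _ j _ h
    exact (List.cons.inj h).1
  · intro u _ v _ huv
    rw [Function.onFun, Finset.disjoint_left]
    intro w hu hv
    obtain ⟨i, -, rfl⟩ := Finset.mem_image.1 hu
    obtain ⟨j, -, h⟩ := Finset.mem_image.1 hv
    exact huv (List.cons.inj h).2.symm

/-- Each edge of the tree joins a unique vertex other than the root to its parent. -/
theorem sum_edgeFinset_treeGraph {k : ℕ} {_ : Fintype (treeGraph c k).edgeSet}
    (x : firstGenerations c k → ℤˣ) :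
    ∑ e ∈ (treeGraph c k).edgeFinset, edgeSpin x e =
      ∑ v : firstGenerations c k, if v.1 = [] then 0 else
        spin (x v) * spin (x ⟨v.1.tail, tail_mem_firstGenerations v.2⟩) := by
  have : ∀ v : firstGenerations c k, (if v.1 = [] then 0 else
        spin (x v) * spin (x ⟨v.1.tail, tail_mem_firstGenerations v.2⟩)) =
      if v.1 ≠ [] then spin (x v) * spin (x ⟨v.1.tail, tail_mem_firstGenerations v.2⟩) else 0 :=
    fun v => by simp only [ne_eq, ite_not]
  rw [Finset.sum_congr rfl fun v _ => this v, ← Finset.sum_filter]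
  symm
  refine Finset.sum_bij (fun v _ => s(v, ⟨v.1.tail, tail_mem_firstGenerations v.2⟩)) ?_ ?_ ?_ ?_
  · rintro ⟨v, hv⟩ h
    rw [SimpleGraph.mem_edgeFinset, SimpleGraph.mem_edgeSet, treeGraph, SimpleGraph.fromRel_adj]
    cases v with
    | nil => simp at h
    | cons i v => exact ⟨fun h => by simpa using congrArg (fun z => z.1.length) h, Or.inr ⟨i, rfl⟩⟩
  · rintro ⟨u, hu⟩ h1 ⟨v, hv⟩ h2 h
    cases u with
    | nil => simp at h1
    | cons i u =>
      cases v with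
      | nil => simp at h2
      | cons j v =>
        simp only [Sym2.eq_iff, Subtype.mk.injEq, List.tail_cons] at h
        rcases h with h | ⟨h, h'⟩
        · exact Subtype.ext h.1
        -- Each vertex would be the parent of the other, which the lengths forbid.
        · have e1 := congrArg List.length h
          have e2 := congrArg List.length h'
          simp only [List.length_cons] at e1 e2
          omega
  · intro e
    induction e using Sym2.ind with
    | _ u v =>
      intro h
      rw [SimpleGraph.mem_edgeFinset, SimpleGraph.mem_edgeSet, treeGraph,
        SimpleGraph.fromRel_adj] at h
      rcases h.2 with ⟨i, hi⟩ | ⟨i, hi⟩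
      · refine ⟨v, by simp [hi], ?_⟩
        rw [Sym2.eq_swap]
        congr
        simp [hi]
      · refine ⟨u, by simp [hi], ?_⟩
        congr
        simp [hi]
  · intro v _
    rfl

/-! ### Summing over spin configurations -/

@[simp]
theorem spin_one : spin 1 = 1 := by simp [spin]

@[simp]
theorem spin_neg_one : spin (-1) = -1 := by simp [spin]

theorem sum_spin {M : Type*} [AddCommMonoid M] (f : ℤˣ → M) : ∑ s, f s = f 1 + f (-1) := by
  rw [UnitsInt.univ, Finset.sum_pair (by decide)]

/-- The extension of a configuration by `1`. -/
def extend {S : Finset (List ℕ)} (x : S → ℤˣ) (v : List ℕ) : ℤˣ :=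
  if h : v ∈ S then x ⟨v, h⟩ else 1

theorem extend_of_mem {S : Finset (List ℕ)} (x : S → ℤˣ) {v : List ℕ} (h : v ∈ S) :
    extend x v = x ⟨v, h⟩ := dif_pos h

theorem extend_of_notMem {S : Finset (List ℕ)} (x : S → ℤˣ) {v : List ℕ} (h : v ∉ S) :
    extend x v = 1 := dif_neg h

/-- Extension is by the neutral element of `ℤˣ`, so multiplying extensions glues configurations on
disjoint sets. -/
theorem sum_config_union {S L : Finset (List ℕ)} (h : Disjoint S L) (F : (List ℕ → ℤˣ) → ℝ) :
    ∑ x : ↥(S ∪ L) → ℤˣ, F (extend x) =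
      ∑ x : S → ℤˣ, ∑ y : L → ℤˣ, F (extend x * extend y) := by
  rw [← Fintype.sum_prod_type']
  have hx : ∀ (p : (S → ℤˣ) × (L → ℤˣ)) (v : S), (extend p.1 * extend p.2) v.1 = p.1 v :=
    fun p v => by
      rw [Pi.mul_apply, extend_of_mem _ v.2, extend_of_notMem _ (Finset.disjoint_left.1 h v.2),
        mul_one]
  have hy : ∀ (p : (S → ℤˣ) × (L → ℤˣ)) (v : L), (extend p.1 * extend p.2) v.1 = p.2 v :=
    fun p v => by
      rw [Pi.mul_apply, extend_of_mem _ v.2, extend_of_notMem _ (Finset.disjoint_right.1 h v.2),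
        one_mul]
  refine Fintype.sum_equiv
    { toFun := fun x => (fun v => x ⟨v, Finset.mem_union_left _ v.2⟩,
        fun v => x ⟨v, Finset.mem_union_right _ v.2⟩)
      invFun := fun p v => (extend p.1 * extend p.2) v.1
      left_inv := ?_
      right_inv := ?_ } _ _ ?_
  · rintro x
    funext ⟨v, hv⟩
    rcases Finset.mem_union.1 hv with h' | h'
    · exact hx _ ⟨v, h'⟩
    · exact hy _ ⟨v, h'⟩
  · intro p
    exact Prod.ext (funext fun v => hx p v) (funext fun v => hy p v)
  · intro x
    congr 1
    funext v
    by_cases h1 : v ∈ S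
    · rw [extend_of_mem _ (Finset.mem_union_left _ h1)]
      exact (hx (fun v => x ⟨v, Finset.mem_union_left _ v.2⟩,
        fun v => x ⟨v, Finset.mem_union_right _ v.2⟩) ⟨v, h1⟩).symm
    · by_cases h2 : v ∈ L
      · rw [extend_of_mem _ (Finset.mem_union_right _ h2)]
        exact (hy (fun v => x ⟨v, Finset.mem_union_left _ v.2⟩,
          fun v => x ⟨v, Finset.mem_union_right _ v.2⟩) ⟨v, h2⟩).symm
      · rw [extend_of_notMem _ (by simp [h1, h2])]
        simp only [Equiv.coe_fn_mk, Pi.mul_apply]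
        rw [extend_of_notMem _ h1, extend_of_notMem _ h2, mul_one]

theorem sum_config_prod (L : Finset (List ℕ)) (ψ : List ℕ → ℤˣ → ℝ) :
    ∑ y : L → ℤˣ, ∏ w ∈ L, ψ w (extend y w) = ∏ w ∈ L, ∑ s, ψ w s := by
  rw [← Finset.prod_coe_sort L fun w => ∑ s, ψ w s,
    Fintype.prod_sum fun (w : L) s => ψ w.1 s]
  refine Finset.sum_congr rfl fun y _ => ?_
  rw [← Finset.prod_coe_sort L fun w => ψ w (extend y w)]
  exact Finset.prod_congr rfl fun w _ => by rw [extend_of_mem _ w.2]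

/-! ### Boltzmann weights on a tree -/

/-- The contribution of `v` and of the edge above it to the exponent of the Boltzmann weight. -/
def vertexEnergy (β : ℝ) (B : List ℕ → ℝ) (X : List ℕ → ℤˣ) (v : List ℕ) : ℝ :=
  (if v = [] then 0 else β * (spin (X v) * spin (X v.tail))) + B v * spin (X v)

/-- The Boltzmann weight of the tree with the additional field `a` on the last generation. -/
def leafWeight (β : ℝ) (c : List ℕ → ℕ) (B a : List ℕ → ℝ) (k : ℕ) (X : List ℕ → ℤˣ) : ℝ :=
  Real.exp (∑ v ∈ firstGenerations c k, vertexEnergy β B X v +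
    ∑ v ∈ generation c k, a v * spin (X v))

/-- Each edge is charged to its lower endpoint, making the exponent a sum over vertices. -/
theorem isingWeight_treeGraph (β : ℝ) (B : List ℕ → ℝ) (k : ℕ) (x : firstGenerations c k → ℤˣ) :
    isingWeight (treeGraph c k) β (fun i => B i.1) x =
      Real.exp (∑ v ∈ firstGenerations c k, vertexEnergy β B (extend x) v) := by
  rw [isingWeight, sum_edgeFinset_treeGraph, Finset.mul_sum, ← Finset.sum_add_distrib,
    ← Finset.sum_coe_sort (firstGenerations c k)]
  congr 1
  refine Finset.sum_congr rfl fun v _ => ?_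
  rw [vertexEnergy, extend_of_mem _ v.2, extend_of_mem _ (tail_mem_firstGenerations v.2)]
  split_ifs <;> simp

theorem vertexEnergy_congr {B : List ℕ → ℝ} {X Y : List ℕ → ℤˣ} {v : List ℕ} (h : X v = Y v)
    (h' : X v.tail = Y v.tail) : vertexEnergy β B X v = vertexEnergy β B Y v := by
  rw [vertexEnergy, vertexEnergy, h, h']

/-- Summing out the spins of the last generation, with arbitrary single-spin weights `φ`, leaves
effective fields on the generation before. -/
theorem sum_last_generation (B u A : List ℕ → ℝ) (φ : List ℕ → ℤˣ → ℝ) (k : ℕ)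
    (hφ : ∀ w, ∀ t : ℤˣ, ∑ s, φ w s * Real.exp (β * (spin s * spin t)) =
      A w * Real.exp (u w * spin t)) (f : ℤˣ → ℝ) :
    ∑ x : firstGenerations c (k + 1) → ℤˣ, f (extend x []) *
        (Real.exp (∑ v ∈ firstGenerations c k, vertexEnergy β B (extend x) v) *
          ∏ w ∈ generation c (k + 1), φ w (extend x w) *
            Real.exp (β * (spin (extend x w) * spin (extend x w.tail)))) =
      (∏ w ∈ generation c (k + 1), A w) *
        ∑ x : firstGenerations c k → ℤˣ, f (extend x []) *
          leafWeight β c B (fun v => ∑ i ∈ Finset.range (c v), u (i :: v)) k (extend x) := by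
  rw [firstGenerations_succ, sum_config_union (disjoint_firstGenerations_generation k)
    (fun X => f (X []) * (Real.exp (∑ v ∈ firstGenerations c k, vertexEnergy β B X v) *
      ∏ w ∈ generation c (k + 1), φ w (X w) * Real.exp (β * (spin (X w) * spin (X w.tail))))),
    Finset.mul_sum]
  refine Finset.sum_congr rfl fun x _ => ?_
  have hin : ∀ (y : generation c (k + 1) → ℤˣ), ∀ v ∈ firstGenerations c k,
      (extend x * extend y) v = extend x v := fun y v hv => by
    rw [Pi.mul_apply, extend_of_notMem y
      (Finset.disjoint_left.1 (disjoint_firstGenerations_generation k) hv), mul_one]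
  have hout : ∀ (y : generation c (k + 1) → ℤˣ), ∀ w ∈ generation c (k + 1),
      (extend x * extend y) w = extend y w := fun y w hw => by
    rw [Pi.mul_apply, extend_of_notMem x
      (Finset.disjoint_right.1 (disjoint_firstGenerations_generation k) hw), one_mul]
  have htail : ∀ w ∈ generation c (k + 1), w.tail ∈ generation c k := fun w hw => by
    cases w with
    | nil => simpa using length_of_mem_generation hw
    | cons i w => exact (cons_mem_generation.1 hw).1
  have htail' : ∀ w ∈ generation c (k + 1), w.tail ∈ firstGenerations c k := fun w hw =>
    mem_firstGenerations.2 (by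
      have := length_of_mem_generation (htail w hw)
      exact ⟨this.le, by rw [this]; exact htail w hw⟩)
  have key : ∀ y : generation c (k + 1) → ℤˣ,
      f ((extend x * extend y) []) *
        (Real.exp (∑ v ∈ firstGenerations c k, vertexEnergy β B (extend x * extend y) v) *
          ∏ w ∈ generation c (k + 1), φ w ((extend x * extend y) w) *
            Real.exp (β * (spin ((extend x * extend y) w) *
              spin ((extend x * extend y) w.tail)))) =
      f (extend x []) * Real.exp (∑ v ∈ firstGenerations c k, vertexEnergy β B (extend x) v) *
        ∏ w ∈ generation c (k + 1), (fun w s => φ w s *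
            Real.exp (β * (spin s * spin (extend x w.tail)))) w (extend y w) := fun y => by
    rw [hin y [] (root_mem_firstGenerations c k), mul_assoc,
      Finset.sum_congr rfl fun v hv => vertexEnergy_congr (hin y v hv)
        (hin y _ (tail_mem_firstGenerations hv)),
      Finset.prod_congr rfl fun w hw => by rw [hout y w hw, hin y _ (htail' w hw)]]
  rw [Finset.sum_congr rfl fun y _ => key y, ← Finset.mul_sum,
    sum_config_prod _ fun w s => φ w s * Real.exp (β * (spin s * spin (extend x w.tail))),
    Finset.prod_congr rfl fun w _ => hφ w (extend x w.tail), Finset.prod_mul_distrib,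
    ← Real.exp_sum, leafWeight, Real.exp_add, sum_generation_succ]
  simp only [List.tail_cons, Finset.sum_mul]
  ring

/-- The spin of a vertex with field `h`, summed against the weight of the edge to its parent. -/
theorem sum_spin_message (β h : ℝ) (t : ℤˣ) :
    ∑ s, Real.exp (h * spin s) * Real.exp (β * (spin s * spin t)) =
      (2 * Real.sqrt (Real.cosh (h + β) * Real.cosh (h - β))) *
        Real.exp (message β h * spin t) := by
  have c1 := Real.cosh_pos (h + β)
  have c2 := Real.cosh_pos (h - β)
  -- The identity amounts to `2 cosh (h ± β) = A exp (± u)`: `A` is the geometric mean of the two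
  -- sides and `u` is half the logarithm of their ratio.
  have s1 : Real.sqrt (Real.cosh (h + β)) = Real.exp (Real.log (Real.cosh (h + β)) / 2) := by
    rw [← Real.exp_log (Real.sqrt_pos.2 c1), Real.log_sqrt c1.le]
  have s2 : Real.sqrt (Real.cosh (h - β)) = Real.exp (Real.log (Real.cosh (h - β)) / 2) := by
    rw [← Real.exp_log (Real.sqrt_pos.2 c2), Real.log_sqrt c2.le]
  rw [sum_spin, ← Real.exp_add, ← Real.exp_add, Real.sqrt_mul c1.le, s1, s2, mul_assoc,
    ← Real.exp_add, ← Real.exp_add, message]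
  rcases Int.units_eq_one_or t with rfl | rfl
  · have e : Real.log (Real.cosh (h + β)) / 2 + Real.log (Real.cosh (h - β)) / 2 +
        (Real.log (Real.cosh (h + β)) - Real.log (Real.cosh (h - β))) / 2 * spin 1 =
        Real.log (Real.cosh (h + β)) := by rw [spin_one]; ring
    rw [e, Real.exp_log c1, Real.cosh_eq]
    simp only [spin_one, spin_neg_one]
    ring_nf
  · have e : Real.log (Real.cosh (h + β)) / 2 + Real.log (Real.cosh (h - β)) / 2 +
        (Real.log (Real.cosh (h + β)) - Real.log (Real.cosh (h - β))) / 2 * spin (-1) =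
        Real.log (Real.cosh (h - β)) := by rw [spin_neg_one]; ring
    rw [e, Real.exp_log c2, Real.cosh_eq]
    simp only [spin_one, spin_neg_one]
    ring_nf

/-- Separation of the last generation in the Boltzmann weight. -/
theorem exp_sum_vertexEnergy_succ (B : List ℕ → ℝ) (k : ℕ) (X : List ℕ → ℤˣ) :
    Real.exp (∑ v ∈ firstGenerations c (k + 1), vertexEnergy β B X v) =
      Real.exp (∑ v ∈ firstGenerations c k, vertexEnergy β B X v) *
        ∏ w ∈ generation c (k + 1), Real.exp (B w * spin (X w)) *
          Real.exp (β * (spin (X w) * spin (X w.tail))) := by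
  rw [firstGenerations_succ, Finset.sum_union (disjoint_firstGenerations_generation k),
    Real.exp_add, Real.exp_sum (generation c (k + 1))]
  congr 1
  refine Finset.prod_congr rfl fun w hw => ?_
  have : w ≠ [] := fun h => by simpa [h] using length_of_mem_generation hw
  rw [vertexEnergy, if_neg this, Real.exp_add, mul_comm]

/-- The prefactor does not depend on `f`, so it cancels between `f = spin` and `f = 1`. -/
theorem sum_leafWeight_succ (B a : List ℕ → ℝ) (k : ℕ) (f : ℤˣ → ℝ) :
    ∑ x : firstGenerations c (k + 1) → ℤˣ, f (extend x []) *
        leafWeight β c B a (k + 1) (extend x) =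
      (∏ w ∈ generation c (k + 1), 2 * Real.sqrt (Real.cosh (B w + a w + β) *
          Real.cosh (B w + a w - β))) *
        ∑ x : firstGenerations c k → ℤˣ, f (extend x []) *
          leafWeight β c B (fun v => ∑ i ∈ Finset.range (c v),
            message β (B (i :: v) + a (i :: v))) k (extend x) := by
  rw [← sum_last_generation B (fun w => message β (B w + a w)) _
    (fun w s => Real.exp ((B w + a w) * spin s)) k (fun w t => sum_spin_message β _ t)]
  refine Finset.sum_congr rfl fun x _ => ?_
  rw [leafWeight, Real.exp_add, exp_sum_vertexEnergy_succ,
    Real.exp_sum (generation c (k + 1)), mul_assoc (Real.exp _),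
    ← Finset.prod_mul_distrib]
  congr 2
  refine Finset.prod_congr rfl fun w _ => ?_
  rw [add_mul, Real.exp_add]
  ring

/-- The root magnetization is the hyperbolic tangent of the effective field at the root. -/
theorem sum_leafWeight_div (B a : List ℕ → ℝ) (k : ℕ) :
    (∑ x : firstGenerations c k → ℤˣ, spin (extend x []) * leafWeight β c B a k (extend x)) /
        ∑ x : firstGenerations c k → ℤˣ, 1 * leafWeight β c B a k (extend x) =
      Real.tanh (cavity β c B (fun v => B v + a v) k []) := by
  induction k generalizing a with
  | zero =>
    have h0 : firstGenerations c 0 = ∅ ∪ {[]} := by simp [firstGenerations, generation]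
    have h1 : ∀ f : ℤˣ → ℝ, ∑ x : firstGenerations c 0 → ℤˣ,
        f (extend x []) * leafWeight β c B a 0 (extend x) =
        ∑ s, f s * Real.exp ((B [] + a []) * spin s) := fun f => by
      have h2 : ∀ X : List ℕ → ℤˣ, f (X []) * leafWeight β c B a 0 X =
          f (X []) * Real.exp ((B [] + a []) * spin (X [])) := fun X => by
        rw [leafWeight, h0]; simp [generation, vertexEnergy, add_mul]
      simp only [h2]
      rw [h0, sum_config_union (by simp)
        fun X => f (X []) * Real.exp ((B [] + a []) * spin (X []))]
      have h3 := sum_config_prod {[]} fun _ s => f s * Real.exp ((B [] + a []) * spin s)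
      simp only [Finset.prod_singleton] at h3
      rw [← h3]
      simp [extend_of_notMem]
    rw [h1, h1 fun _ => 1, sum_spin, sum_spin, cavity, Real.tanh_eq_sinh_div_cosh, Real.sinh_eq,
      Real.cosh_eq, div_div_div_cancel_right₀ two_ne_zero]
    simp [sub_eq_add_neg]
  | succ k ih =>
    have hA : ∏ w ∈ generation c (k + 1), 2 * Real.sqrt (Real.cosh (B w + a w + β) *
          Real.cosh (B w + a w - β)) ≠ 0 := by
      refine (Finset.prod_pos fun w _ => ?_).ne'
      have := Real.cosh_pos (B w + a w + β)
      have := Real.cosh_pos (B w + a w - β)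
      positivity
    rw [sum_leafWeight_succ, sum_leafWeight_succ B a k fun _ => 1, mul_div_mul_left _ _ hA, ih,
      cavity_succ]

theorem bracket_boltzmann {X : Type*} [Fintype X] (w f : X → ℝ) :
    bracket (boltzmann w) f = (∑ x, f x * w x) / ∑ x, 1 * w x := by
  simp only [bracket, boltzmann, one_mul, Finset.sum_div, mul_div_assoc]

theorem freeMagnetization_eq (β : ℝ) (c : List ℕ → ℕ) (B : List ℕ → ℝ) (l : ℕ) :
    freeMagnetization β c B l = Real.tanh (cavity β c B B l []) := by
  have h := sum_leafWeight_div (β := β) (c := c) B (fun _ => 0) l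
  simp only [add_zero] at h
  rw [← h, freeMagnetization, freeMeasure, bracket_boltzmann]
  simp only [isingWeight_treeGraph, leafWeight, zero_mul, Finset.sum_const_zero, add_zero,
    extend_of_mem _ (root_mem_firstGenerations c l), root]

/-- A leaf pinned to `+1` contributes its own field only as a constant factor and acts on its parent
as the field `β`; hence the depth drops by one and `v` gains `β * c v`. -/
theorem plusMagnetization_eq (β : ℝ) (c : List ℕ → ℕ) (B : List ℕ → ℝ) (k : ℕ) :
    plusMagnetization β c B (k + 1) =
      Real.tanh (cavity β c B (fun v => B v + β * c v) k []) := by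
  classical
  have key := fun f : ℤˣ → ℝ => sum_last_generation (β := β) (c := c) B (fun _ => β)
    (fun w => Real.exp (B w)) (fun w s => if s = 1 then Real.exp (B w * spin s) else 0) k
    (fun w t => by simp) f
  have hA : ∏ w ∈ generation c (k + 1), Real.exp (B w) ≠ 0 :=
    (Finset.prod_pos fun w _ => Real.exp_pos _).ne'
  have hw : ∀ x : firstGenerations c (k + 1) → ℤˣ,
      isingWeight (treeGraph c (k + 1)) β (fun i => B i.1) x *
        (if ∀ i : firstGenerations c (k + 1), i.1 ∈ generation c (k + 1) → x i = 1
          then 1 else 0) =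
      Real.exp (∑ v ∈ firstGenerations c k, vertexEnergy β B (extend x) v) *
        ∏ w ∈ generation c (k + 1),
          (if extend x w = 1 then Real.exp (B w * spin (extend x w)) else 0) *
            Real.exp (β * (spin (extend x w) * spin (extend x w.tail))) := fun x => by
    have hmem : ∀ w ∈ generation c (k + 1), w ∈ firstGenerations c (k + 1) := fun w hw => by
      rw [firstGenerations_succ]; exact Finset.mem_union_right _ hw
    rw [isingWeight_treeGraph, exp_sum_vertexEnergy_succ]
    split_ifs with h
    · rw [mul_one]
      congr 1
      refine Finset.prod_congr rfl fun w hw => ?_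
      rw [if_pos]
      rw [extend_of_mem _ (hmem w hw)]
      exact h ⟨w, hmem w hw⟩ hw
    · push Not at h
      obtain ⟨i, hi, hne⟩ := h
      rw [mul_zero, Finset.prod_eq_zero hi, mul_zero]
      rw [extend_of_mem _ i.2, if_neg hne, zero_mul]
  have h := sum_leafWeight_div (β := β) (c := c) B (fun v => β * c v) k
  rw [← h, plusMagnetization, plusMeasure, bracket_boltzmann]
  have hroot : ∀ x : firstGenerations c (k + 1) → ℤˣ, x (root c (k + 1)) = extend x [] :=
    fun x => (extend_of_mem x (root_mem_firstGenerations c (k + 1))).symm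
  have hu : (fun v : List ℕ => ∑ _i ∈ Finset.range (c v), β) = fun v => β * c v := by
    funext v; simp [mul_comm]
  simp only [hroot]
  rw [Finset.sum_congr rfl fun x _ => congrArg (spin (extend x []) * ·) (hw x),
    Finset.sum_congr rfl fun x _ => congrArg ((1 : ℝ) * ·) (hw x), key spin, key fun _ => 1,
    mul_div_mul_left _ _ hA, hu]

/-! ### Dependence on the tree -/

theorem eq_of_firstGenerations_eq {c' : List ℕ → ℕ} {k : ℕ}
    (h : firstGenerations c k = firstGenerations c' k) {v : List ℕ}
    (hv : v ∈ firstGenerations c k) (hk : v.length < k) : c v = c' v := by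
  have key : ∀ c : List ℕ → ℕ, v ∈ firstGenerations c k →
      ∀ i, i :: v ∈ firstGenerations c k ↔ i < c v := fun c hv i => by
    rw [mem_firstGenerations, List.length_cons, cons_mem_generation]
    exact ⟨fun h => h.2.2, fun h => ⟨hk, (mem_firstGenerations.1 hv).2, h⟩⟩
  have h1 := key c hv
  have h2 := key c' (h ▸ hv)
  rw [← h] at h2
  exact eq_of_forall_lt_iff fun i => (h1 i).symm.trans (h2 i)

/-- Only values on the tree matter. This allows freezing the tree on an event that fixes its first
generations, and altering the field off the tree. -/
theorem cavity_congr {c' : List ℕ → ℕ} {B B' g g' : List ℕ → ℝ} {l : ℕ}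
    (hc : ∀ v ∈ firstGenerations c l, v.length < l → c v = c' v)
    (hB : ∀ v ∈ firstGenerations c l, v.length < l → B v = B' v)
    (hg : ∀ v ∈ firstGenerations c l, v.length = l → g v = g' v) {n : ℕ} {v : List ℕ}
    (hv : v ∈ generation c v.length) (hn : v.length + n = l) :
    cavity β c B g n v = cavity β c' B' g' n v := by
  have hv' : v ∈ firstGenerations c l := mem_firstGenerations.2 ⟨by omega, hv⟩
  induction n generalizing v with
  | zero => exact hg v hv' hn
  | succ n ih =>
    rw [cavity, cavity, hB v hv' (by omega), ← hc v hv' (by omega)]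
    congr 1
    refine Finset.sum_congr rfl fun i hi => ?_
    have hi' : i :: v ∈ generation c (i :: v).length :=
      cons_mem_generation.2 ⟨hv, Finset.mem_range.1 hi⟩
    have hl : (i :: v).length + n = l := by rw [List.length_cons]; omega
    rw [ih hi' hl (mem_firstGenerations.2 ⟨by omega, hi'⟩)]

theorem cavity_root_congr {c' : List ℕ → ℕ} {B B' g g' : List ℕ → ℝ} {l : ℕ}
    (hc : ∀ v ∈ firstGenerations c l, v.length < l → c v = c' v)
    (hB : ∀ v ∈ firstGenerations c l, v.length < l → B v = B' v)
    (hg : ∀ v ∈ firstGenerations c l, v.length = l → g v = g' v) :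
    cavity β c B g l [] = cavity β c' B' g' l [] :=
  cavity_congr hc hB hg (Finset.mem_singleton_self _) (zero_add l)

/-! ### Measurability -/

section Measurable

variable {Ω : Type*} [MeasurableSpace Ω] {N : List ℕ → Ω → ℕ}

theorem measurable_sum_range {n : Ω → ℕ} {f : ℕ → Ω → ℝ} (hn : Measurable n)
    (hf : ∀ i, Measurable (f i)) : Measurable fun ω => ∑ i ∈ Finset.range (n ω), f i ω := by
  have : Measurable fun p : Ω × ℕ => ∑ i ∈ Finset.range p.2, f i p.1 :=
    measurable_from_prod_countable_left fun m =>
      Finset.measurable_fun_sum (Finset.range m) fun i _ => hf i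
  exact this.comp (measurable_id.prodMk hn)

theorem measurable_cavity {B g : List ℕ → Ω → ℝ} (hN : ∀ v, Measurable (N v))
    (hB : ∀ v, Measurable (B v)) (hg : ∀ v, Measurable (g v)) (n : ℕ) (v : List ℕ) :
    Measurable fun ω => cavity β (fun u => N u ω) (fun u => B u ω) (fun u => g u ω) n v := by
  induction n generalizing v with
  | zero => exact hg v
  | succ n ih =>
    simp only [cavity]
    exact (hB v).add (measurable_sum_range (hN v) fun i =>
      (continuous_message β).measurable.comp (ih (i :: v)))

theorem measurableSet_mem_generation (hN : ∀ v, Measurable (N v)) (k : ℕ) (v : List ℕ) :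
    MeasurableSet {ω | v ∈ generation (fun u => N u ω) k} := by
  induction k generalizing v with
  | zero => exact MeasurableSet.const _
  | succ k ih =>
    cases v with
    | nil =>
      convert MeasurableSet.empty using 1
      ext ω
      simp only [Set.mem_ofPred_eq, Set.mem_empty_iff_false, iff_false]
      exact fun h => by simpa using length_of_mem_generation h
    | cons i v =>
      simp only [cons_mem_generation]
      exact (ih v).inter (measurableSet_lt measurable_const (hN v))

theorem measurableSet_firstGenerations_eq (hN : ∀ v, Measurable (N v)) (k : ℕ)
    (t : Finset (List ℕ)) : MeasurableSet {ω | firstGenerations (fun u => N u ω) k = t} := by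
  have : {ω | firstGenerations (fun u => N u ω) k = t} =
      ⋂ v : List ℕ, {ω | (v.length ≤ k ∧ v ∈ generation (fun u => N u ω) v.length) ↔ v ∈ t} := by
    ext ω
    simp only [Finset.ext_iff, mem_firstGenerations, Set.mem_ofPred_eq, Set.mem_iInter]
  rw [this]
  refine MeasurableSet.iInter fun v => ?_
  have h := (MeasurableSet.const (v.length ≤ k)).inter (measurableSet_mem_generation hN v.length v)
  by_cases hv : v ∈ t
  · simp only [hv, iff_true]
    exact h
  · simp only [hv, iff_false]
    exact h.compl

theorem integrable_tanh {P : Measure Ω} [IsFiniteMeasure P] {f : Ω → ℝ}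
    (hf : AEStronglyMeasurable f P) : Integrable (fun ω => Real.tanh (f ω)) P :=
  Integrable.of_bound (continuous_tanh.comp_aestronglyMeasurable hf) 1
    (ae_of_all _ fun _ => abs_tanh_le_one _)

end Measurable

/-! ### Averaging over the last generation -/

section Jensen

variable {Ω : Type*} [MeasurableSpace Ω]

/-- Jensen applies to each message going up from the leaves; monotonicity then carries the
inequality through the levels above. -/
theorem integral_cavity_le (hβ : 0 ≤ β) (μ : Measure Ω) [IsProbabilityMeasure μ]
    {B : List ℕ → ℝ} (hB : ∀ v, 0 ≤ B v) {g : List ℕ → Ω → ℝ} (hg : ∀ v ω, 0 ≤ g v ω)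
    (hgi : ∀ v, Integrable (g v) μ) (n : ℕ) (v : List ℕ) :
    Integrable (fun ω => cavity β c B (fun u => g u ω) n v) μ ∧
      ∫ ω, cavity β c B (fun u => g u ω) n v ∂μ ≤
        cavity β c B (fun u => ∫ ω, g u ω ∂μ) n v := by
  induction n generalizing v with
  | zero => exact ⟨hgi v, le_rfl⟩
  | succ n ih =>
    have hm : ∀ i, Integrable
        (fun ω => message β (cavity β c B (fun u => g u ω) n (i :: v))) μ := fun i => by
      refine Integrable.of_bound
        ((continuous_message β).comp_aestronglyMeasurable (ih (i :: v)).1.1) β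
        (ae_of_all _ fun ω => ?_)
      rw [Real.norm_eq_abs, abs_of_nonneg (message_nonneg hβ
        (cavity_nonneg hβ hB (fun u => hg u ω) _ _))]
      exact message_le hβ _
    simp only [cavity]
    refine ⟨(integrable_const _).add (integrable_finsetSum _ fun i _ => hm i), ?_⟩
    rw [integral_add (integrable_const _) (integrable_finsetSum _ fun i _ => hm i),
      integral_finsetSum _ fun i _ => hm i, integral_const, probReal_univ, one_smul]
    gcongr with i
    refine ((concaveOn_message hβ).le_map_integral (continuous_message β).continuousOn isClosed_Ici
      (ae_of_all _ fun ω => cavity_nonneg hβ hB (fun u => hg u ω) _ _) (ih (i :: v)).1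
      (hm i)).trans ?_
    exact monotone_message hβ (ih (i :: v)).2

theorem integral_tanh_cavity_le (hβ : 0 ≤ β) (μ : Measure Ω) [IsProbabilityMeasure μ]
    {B : List ℕ → ℝ} (hB : ∀ v, 0 ≤ B v) {g : List ℕ → Ω → ℝ} (hg : ∀ v ω, 0 ≤ g v ω)
    (hgi : ∀ v, Integrable (g v) μ) (n : ℕ) (v : List ℕ) :
    ∫ ω, Real.tanh (cavity β c B (fun u => g u ω) n v) ∂μ ≤
      Real.tanh (cavity β c B (fun u => ∫ ω, g u ω ∂μ) n v) := by
  obtain ⟨hi, hle⟩ := integral_cavity_le (c := c) hβ μ hB hg hgi n v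
  exact (concaveOn_tanh.le_map_integral continuous_tanh.continuousOn isClosed_Ici
    (ae_of_all _ fun ω => cavity_nonneg hβ hB (fun u => hg u ω) _ _) hi
    (integrable_tanh hi.1)).trans (monotone_tanh hle)

variable {P : Measure Ω} {N : List ℕ → Ω → ℕ} {Δ : ℝ}

theorem setIntegral_eq_cond [IsFiniteMeasure P] {A : Set Ω} (hA : P A ≠ 0) (f : Ω → ℝ) :
    ∫ ω in A, f ω ∂P = P.real A * ∫ ω, f ω ∂(ProbabilityTheory.cond P A) := by
  have : P.real A ≠ 0 := by
    rw [measureReal_def]; exact ENNReal.toReal_ne_zero.2 ⟨hA, measure_ne_top _ _⟩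
  rw [ProbabilityTheory.cond, integral_smul_measure, ENNReal.toReal_inv, ← measureReal_def,
    smul_eq_mul, mul_inv_cancel_left₀ this]

/-- Given the first `k` generations, the plus boundary condition one generation further acts at
most like the mean field. -/
theorem setIntegral_tanh_cavity_le [IsProbabilityMeasure P]
    (hT : IsConditionallyIndependentTree P N Δ) (hβ : 0 ≤ β) {b K : ℝ} (hb : 0 ≤ b) (hK : 0 ≤ K)
    (hΔ : β * Δ ≤ K) (k : ℕ) (t : Finset (List ℕ)) :
    ∫ ω in {ω | firstGenerations (fun v => N v ω) k = t},
        Real.tanh (cavity β (fun v => N v ω) (fun _ => b) (fun v => b + β * N v ω) k []) ∂P ≤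
      ∫ ω in {ω | firstGenerations (fun v => N v ω) k = t},
        Real.tanh (cavity β (fun v => N v ω) (fun _ => b) (fun _ => b + K) k []) ∂P := by
  classical
  set A := {ω | firstGenerations (fun v => N v ω) k = t} with hAdef
  by_cases hA : P A = 0
  · rw [setIntegral_measure_zero _ hA, setIntegral_measure_zero _ hA]
  have hmA : MeasurableSet A := measurableSet_firstGenerations_eq hT.measurable k t
  -- On `A` the tree down to generation `k` is that of `ω₀`; only the offspring numbers of the
  -- leaves of `t` stay random.
  obtain ⟨ω₀, hω₀⟩ : A.Nonempty := nonempty_of_measure_ne_zero hA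
  have := cond_isProbabilityMeasure hA
  rw [setIntegral_eq_cond hA, setIntegral_eq_cond hA]
  refine mul_le_mul_of_nonneg_left ?_ measureReal_nonneg
  -- Off the leaves of `t` nothing is known about the mean of `N v`, so the field is set to `b`
  -- there.
  set g : List ℕ → Ω → ℝ := fun v ω => if v ∈ t ∧ v.length = k then b + β * N v ω else b with hg
  have hg0 : ∀ v ω, 0 ≤ g v ω := fun v ω => by
    simp only [hg]; split_ifs <;> positivity
  have hgi : ∀ v, Integrable (g v) (ProbabilityTheory.cond P A) := fun v => by
    by_cases hv : v ∈ t ∧ v.length = k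
    · simp only [hg, if_pos hv]
      exact (integrable_const _).add ((hT.mean_le k t hA v hv.1 hv.2).1.const_mul β)
    · simp only [hg, if_neg hv]
      exact integrable_const _
  have hgle : ∀ v, ∫ ω, g v ω ∂(ProbabilityTheory.cond P A) ≤ b + K := fun v => by
    by_cases hv : v ∈ t ∧ v.length = k
    · simp only [hg, if_pos hv]
      obtain ⟨hi, hle⟩ := hT.mean_le k t hA v hv.1 hv.2
      rw [integral_add (integrable_const _) (hi.const_mul β), integral_const, probReal_univ,
        one_smul, integral_const_mul]
      linarith [mul_le_mul_of_nonneg_left hle hβ]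
    · simp only [hg, if_neg hv, integral_const, probReal_univ, one_smul]
      linarith
  have hmem : ∀ᵐ ω ∂(ProbabilityTheory.cond P A), ω ∈ A := ae_cond_mem hmA
  have e1 : ∀ ω ∈ A, Real.tanh (cavity β (fun v => N v ω) (fun _ => b)
      (fun v => b + β * N v ω) k []) =
      Real.tanh (cavity β (fun v => N v ω₀) (fun _ => b) (fun v => g v ω) k []) := fun ω hω => by
    rw [cavity_root_congr (c' := fun v => N v ω₀) (g' := fun v => g v ω)
      (fun v hv hk => eq_of_firstGenerations_eq (hω.trans hω₀.symm) hv hk) (fun _ _ _ => rfl)]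
    intro v hv hk
    rw [show firstGenerations (fun v => N v ω) k = t from hω] at hv
    simp only [hg, if_pos (And.intro hv hk)]
  have e2 : ∀ ω ∈ A, Real.tanh (cavity β (fun v => N v ω) (fun _ => b) (fun _ => b + K) k []) =
      Real.tanh (cavity β (fun v => N v ω₀) (fun _ => b) (fun _ => b + K) k []) := fun ω hω => by
    rw [cavity_root_congr (c' := fun v => N v ω₀)
      (fun v hv hk => eq_of_firstGenerations_eq (hω.trans hω₀.symm) hv hk) (fun _ _ _ => rfl)
      (fun _ _ _ => rfl)]
  rw [integral_congr_ae (hmem.mono e1), integral_congr_ae (hmem.mono e2), integral_const,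
    probReal_univ, one_smul]
  exact (integral_tanh_cavity_le hβ _ (fun _ => hb) hg0 hgi k []).trans
    (monotone_tanh (cavity_mono hβ _ hgle k []))

/-- The tree `T(k)` takes countably many values, so the conditional bounds can be summed. -/
theorem integral_tanh_cavity_plus_le [IsProbabilityMeasure P]
    (hT : IsConditionallyIndependentTree P N Δ) (hβ : 0 ≤ β) {b K : ℝ} (hb : 0 ≤ b) (hK : 0 ≤ K)
    (hΔ : β * Δ ≤ K) (k : ℕ) :
    ∫ ω, Real.tanh (cavity β (fun v => N v ω) (fun _ => b) (fun v => b + β * N v ω) k []) ∂P ≤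
      ∫ ω, Real.tanh (cavity β (fun v => N v ω) (fun _ => b) (fun _ => b + K) k []) ∂P := by
  have hmA := measurableSet_firstGenerations_eq hT.measurable k
  have hd : Pairwise (Function.onFun Disjoint
      fun t => {ω | firstGenerations (fun v => N v ω) k = t}) := fun s t hst => by
    rw [Function.onFun, Set.disjoint_left]
    exact fun ω hs ht => hst (hs.symm.trans ht)
  have hU : ⋃ t, {ω | firstGenerations (fun v => N v ω) k = t} = Set.univ :=
    Set.eq_univ_of_forall fun ω => Set.mem_iUnion.2 ⟨_, rfl⟩
  have key : ∀ f : Ω → ℝ, Integrable f P →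
      HasSum (fun t => ∫ ω in {ω | firstGenerations (fun v => N v ω) k = t}, f ω ∂P)
        (∫ ω, f ω ∂P) := fun f hf => by
    have := hasSum_integral_iUnion hmA hd hf.integrableOn
    rwa [hU, setIntegral_univ] at this
  have hm : ∀ v, Measurable fun ω => b + β * (N v ω : ℝ) := fun v =>
    ((measurable_from_top.comp (hT.measurable v)).const_mul β).const_add b
  refine hasSum_le (fun t => setIntegral_tanh_cavity_le hT hβ hb hK hΔ k t) (key _ ?_) (key _ ?_)
  · exact integrable_tanh (measurable_cavity hT.measurable (fun _ => measurable_const) hm k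
      []).aestronglyMeasurable
  · exact integrable_tanh (measurable_cavity hT.measurable (fun _ => measurable_const)
      (fun _ => measurable_const) k []).aestronglyMeasurable

/-! ### Telescoping in a constant field -/

/-- The bound on the expected gap in a constant field. -/
theorem mul_integral_gap_le [IsProbabilityMeasure P]
    (hT : IsConditionallyIndependentTree P N Δ) (hβ : 0 ≤ β) {b K : ℝ} (hb : 0 < b) (hK : 0 < K)
    (hΔ : β * Δ ≤ K) (n : ℕ) :
    ((n + 1 : ℕ) : ℝ) * ∫ ω, (Real.tanh (cavity β (fun v => N v ω) (fun _ => b)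
        (fun v => b + β * N v ω) n []) -
      Real.tanh (cavity β (fun v => N v ω) (fun _ => b) (fun _ => b) (n + 1) [])) ∂P ≤
      2 + K / b := by
  set U : ℕ → Ω → ℝ := fun k ω => Real.tanh (cavity β (fun v => N v ω) (fun _ => b)
    (fun v => b + β * N v ω) k []) with hU
  set V : ℕ → Ω → ℝ := fun k ω => Real.tanh (cavity β (fun v => N v ω) (fun _ => b)
    (fun _ => b + K) k []) with hV
  set F : ℕ → Ω → ℝ := fun k ω => Real.tanh (cavity β (fun v => N v ω) (fun _ => b)
    (fun _ => b) k []) with hF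
  have hm : ∀ v, Measurable fun ω => b + β * (N v ω : ℝ) := fun v =>
    ((measurable_from_top.comp (hT.measurable v)).const_mul β).const_add b
  have iU : ∀ k, Integrable (U k) P := fun k => integrable_tanh (measurable_cavity hT.measurable
    (fun _ => measurable_const) hm k []).aestronglyMeasurable
  have iV : ∀ k, Integrable (V k) P := fun k => integrable_tanh (measurable_cavity hT.measurable
    (fun _ => measurable_const) (fun _ => measurable_const) k []).aestronglyMeasurable
  have iF : ∀ k, Integrable (F k) P := fun k => integrable_tanh (measurable_cavity hT.measurable
    (fun _ => measurable_const) (fun _ => measurable_const) k []).aestronglyMeasurable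
  have F0 : ∀ k ω, 0 ≤ F k ω := fun k ω =>
    tanh_nonneg (cavity_nonneg hβ (fun _ => hb.le) (fun _ => hb.le) _ _)
  have F1 : ∀ k ω, F k ω ≤ 1 := fun k ω => (le_abs_self _).trans (abs_tanh_le_one _)
  have step : ∀ k ∈ Finset.range n, ∫ ω, (U n ω - F (n + 1) ω) ∂P ≤
      K / b * (∫ ω, F (k + 1) ω ∂P - ∫ ω, F k ω ∂P) := fun k hk => by
    rw [Finset.mem_range] at hk
    calc ∫ ω, (U n ω - F (n + 1) ω) ∂P ≤ ∫ ω, (U (k + 1) ω - F (k + 1) ω) ∂P := by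
          refine integral_mono ((iU n).sub (iF _)) ((iU _).sub (iF _)) fun ω => ?_
          exact sub_le_sub (monotone_tanh (cavity_plus_le hβ _ hk []))
            (monotone_tanh (cavity_free_le hβ (fun _ => hb.le) (by omega) []))
      _ = ∫ ω, U (k + 1) ω ∂P - ∫ ω, F (k + 1) ω ∂P := integral_sub (iU _) (iF _)
      _ ≤ ∫ ω, V (k + 1) ω ∂P - ∫ ω, F (k + 1) ω ∂P := by
          gcongr ?_ - _
          exact integral_tanh_cavity_plus_le hT hβ hb.le hK.le hΔ (k + 1)
      _ = ∫ ω, (V (k + 1) ω - F (k + 1) ω) ∂P := (integral_sub (iV _) (iF _)).symm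
      _ ≤ ∫ ω, K / b * (F (k + 1) ω - F k ω) ∂P := by
          refine integral_mono ((iV _).sub (iF _)) (((iF _).sub (iF _)).const_mul _) fun ω => ?_
          exact tanh_cavity_sub_le hβ hb hK k
      _ = _ := by rw [integral_const_mul, integral_sub (iF _) (iF _)]
  have hsum := Finset.sum_le_sum step
  rw [← Finset.mul_sum, Finset.sum_range_sub (fun k => ∫ ω, F k ω ∂P), Finset.sum_const,
    Finset.card_range, nsmul_eq_mul] at hsum
  have hFn : ∫ ω, F n ω ∂P ≤ 1 := by
    simpa using integral_mono (iF n) (integrable_const 1) (F1 n)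
  have hF0 : 0 ≤ ∫ ω, F 0 ω ∂P := integral_nonneg (F0 0)
  have hC : K / b * (∫ ω, F n ω ∂P - ∫ ω, F 0 ω ∂P) ≤ K / b :=
    mul_le_of_le_one_right (by positivity) (by linarith)
  -- Telescoping covers only `n` of the `n + 1` copies; this trivial bound pays for the last one and
  -- for the case `n = 0`.
  have h2 : ∫ ω, (U n ω - F (n + 1) ω) ∂P ≤ 2 := by
    have : ∀ ω, U n ω - F (n + 1) ω ≤ 2 := fun ω => by
      have h1 : U n ω ≤ 1 := (le_abs_self _).trans (abs_tanh_le_one _)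
      linarith [F0 (n + 1) ω]
    simpa using integral_mono ((iU n).sub (iF (n + 1))) (integrable_const 2) this
  push_cast
  rw [add_mul, one_mul]
  linarith

end Jensen

/-! ### Reduction to a constant field, and the theorem -/

/-- Bound on the gap in a field that is at least `b` on the tree by the gap in the field `b`. -/
theorem magnetization_gap_le (hβ : 0 ≤ β) {b : ℝ} (hb : 0 ≤ b) {B : List ℕ → ℝ} {n : ℕ}
    (hB : ∀ v ∈ firstGenerations c (n + 1), b ≤ B v) :
    plusMagnetization β c B (n + 1) - freeMagnetization β c B (n + 1) ≤
      Real.tanh (cavity β c (fun _ => b) (fun v => b + β * c v) n []) -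
        Real.tanh (cavity β c (fun _ => b) (fun _ => b) (n + 1) []) := by
  -- The lower bound on `B` holds only on the tree; `max b (B v)` agrees with it there and satisfies
  -- the bound everywhere.
  have hmax : ∀ v ∈ firstGenerations c (n + 1), B v = max b (B v) := fun v hv =>
    (max_eq_right (hB v hv)).symm
  have hsub : ∀ v ∈ firstGenerations c n, B v = max b (B v) := fun v hv =>
    hmax v (by rw [firstGenerations_succ]; exact Finset.mem_union_left _ hv)
  rw [plusMagnetization_eq, freeMagnetization_eq,
    cavity_root_congr (c' := c) (B' := fun v => max b (B v))
      (g' := fun v => max b (B v) + β * c v) (fun _ _ _ => rfl)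
      (fun v hv _ => hsub v hv) (fun v hv _ => by rw [← hsub v hv]),
    cavity_root_congr (l := n + 1) (c' := c) (B := B) (g := B) (B' := fun v => max b (B v))
      (g' := fun v => max b (B v)) (fun _ _ _ => rfl)
      (fun v hv _ => hmax v hv) (fun v hv _ => hmax v hv)]
  exact tanh_cavity_gap_le hβ (fun _ => hb) (fun v => le_max_left _ _) n

end IsingTree

end

theorem mainTheorem7 (βmax Bmin Δ : ℝ) (hBmin : 0 < Bmin) :
    ∃ M : ℝ, ∀ {Ω : Type*} [MeasurableSpace Ω] (P : Measure Ω) [IsProbabilityMeasure P]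
      (N : List ℕ → Ω → ℕ) (B : List ℕ → Ω → ℝ) (β : ℝ) (l : ℕ),
      IsingTree.IsConditionallyIndependentTree P N Δ →
      (∀ v, Measurable (B v)) →
      0 ≤ β → β ≤ βmax → 1 ≤ l →
      (∀ᵐ ω ∂P, ∀ v ∈ IsingTree.firstGenerations (fun u => N u ω) l, Bmin ≤ B v ω) →
      Integrable (fun ω =>
          IsingTree.plusMagnetization β (fun u => N u ω) (fun u => B u ω) l -
            IsingTree.freeMagnetization β (fun u => N u ω) (fun u => B u ω) l) P ∧
        ∫ ω, (IsingTree.plusMagnetization β (fun u => N u ω) (fun u => B u ω) l -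
            IsingTree.freeMagnetization β (fun u => N u ω) (fun u => B u ω) l) ∂P ≤ M / l := by
  -- Here `K = (|βmax| + 1) * (|Δ| + 1)`, strictly positive and at least `β * Δ` whatever the signs
  -- of the constants.
  refine ⟨2 + (|βmax| + 1) * (|Δ| + 1) / Bmin, ?_⟩
  intro Ω _ P _ N B β l hT hB hβ hβmax hl hBm
  obtain ⟨n, rfl⟩ : ∃ n, l = n + 1 := ⟨l - 1, by omega⟩
  have hN : ∀ v, Measurable fun ω => β * (N v ω : ℝ) := fun v =>
    (measurable_from_top.comp (hT.measurable v)).const_mul β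
  have hint : Integrable (fun ω =>
      IsingTree.plusMagnetization β (fun u => N u ω) (fun u => B u ω) (n + 1) -
        IsingTree.freeMagnetization β (fun u => N u ω) (fun u => B u ω) (n + 1)) P := by
    simp only [IsingTree.plusMagnetization_eq, IsingTree.freeMagnetization_eq]
    exact (IsingTree.integrable_tanh (IsingTree.measurable_cavity hT.measurable hB
      (fun v => (hB v).add (hN v)) n []).aestronglyMeasurable).sub
      (IsingTree.integrable_tanh (IsingTree.measurable_cavity hT.measurable hB hB
        (n + 1) []).aestronglyMeasurable)
  refine ⟨hint, ?_⟩
  have hK : 0 < (|βmax| + 1) * (|Δ| + 1) := by positivity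
  have hΔ : β * Δ ≤ (|βmax| + 1) * (|Δ| + 1) := by
    have h1 : β ≤ |βmax| + 1 := by linarith [le_abs_self βmax]
    calc β * Δ ≤ β * |Δ| := mul_le_mul_of_nonneg_left (le_abs_self Δ) hβ
      _ ≤ _ := mul_le_mul h1 (by linarith) (abs_nonneg _) (by positivity)
  have hgap := IsingTree.mul_integral_gap_le hT hβ hBmin hK hΔ n
  have hle := integral_mono_ae hint
    ((IsingTree.integrable_tanh (IsingTree.measurable_cavity (β := β) hT.measurable
      (fun _ => measurable_const) (fun v => measurable_const.add (hN v)) n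
      []).aestronglyMeasurable).sub
      (IsingTree.integrable_tanh (IsingTree.measurable_cavity (β := β) hT.measurable
        (fun _ => measurable_const) (fun _ => measurable_const) (n + 1) []).aestronglyMeasurable))
    (hBm.mono fun ω hω => IsingTree.magnetization_gap_le hβ hBmin.le hω)
  rw [le_div_iff₀' (by positivity)]
  exact (mul_le_mul_of_nonneg_left hle (by positivity)).trans hgap
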